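/- **Conventions.** An odd form ring $(R,\Delta)$ consists of an associative (not necessarily unital) ring $R$ with an involution $x\mapsto\bar x$, a group $\Delta$ (written additively with operation $\dotplus$, neutral element $\dot 0$, not necessarily commutative) with a right action $(u,x)\mapsto u\cdot x$ of the multiplicative semigroup of $R$ by group endomorphisms, and maps $\phi\colon R\to\Delta$, $\pi,\rho\colon\Delta\to R$ such that - $\pi$ and $\phi$ are group homomorphisms, $\pi(u\cdot x)=\pi(u)x$, $\phi(\bar x y x)=\phi(y)\cdot x$, and $\phi(x)=\dot 0$ if $\bar x=x$; - $u\dotplus\phi(x)=\phi(x)\dotplus u$ and $u\dotplus v=v\dotplus u\dotplus\phi(-\overline{\pi(u)}\pi(v))$; - $\rho(u\dotplus v)=\rho(u)-\overline{\pi(u)}\pi(v)+\rho(v)$, $\overline{\rho(u)}=\rho(\dot- u)$, $\rho(u\cdot x)=\bar x\rho(u)x$; - $\pi(\phi(x))=0$, $\rho(\phi(x))=x-\bar x$, and $u\cdot(x+y)=u\cdot x\dotplus\phi(\bar y\rho(u)x)\dotplus u\cdot y$. It is *semi-local* if $R$ is unital and $R$ modulo its Jacobson radical is a finite product of matrix rings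 over division rings. A *hyperbolic pair* is $\eta=(e_-,e_+,q_-,q_+)$ with $e_\pm\in R$ orthogonal idempotents, $\overline{e_+}=e_-$, and $q_\pm\in\Delta$ with $\pi(q_\pm)=e_\pm$, $\rho(q_\pm)=0$, $q_\pm\cdot e_\pm=q_\pm$. An *orthogonal hyperbolic family* of rank $n$ is a family of hyperbolic pairs $\eta_i=(e_{-i},e_i,q_{-i},q_i)$, $1\le i\le n$, such that for $i\ne j$, with $e_{|i|}=e_{-i}+e_i$, one has $e_{|i|}e_{|j|}=0$ and $e_{|i|}Re_{|j|}Re_{|i|}=e_{|i|}Re_{|i|}$. It is *free* if there are $e_{ij}\in R$ for $1\le i,j\le n$ with $e_{ii}=e_i$ and $e_{ij}e_{jk}=e_{ik}$ for all $i,j,k$. Write $R_1=e_1Re_1$ (a ring with identity $e_1$), $R_{-1,1}=e_{-1}Re_1$, $R_{1,-1}=e_1Re_{-1}$, $e_{0'}=\sum_i e_{|i|}$, and $\Delta^{\mathrm{ev}}=\{\rho(u)\mid u\in\Delta\cdot e_{0'},\ \pi(u)=0\}$. A finite sequence $(x_i)$ in $R_1$ is right unimodular if $\sum_i y_ix_i=e_1$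 for some $y_i\in R_1$. For an integer $k\ge1$, $\mathrm{sr}(R_1)\le k-1$ means that for every right unimodular sequence $x_1,\dots,x_k$ in $R_1$ there are $a_1,\dots,a_{k-1}\in R_1$ such that $x_1+a_1x_k,\dots,x_{k-1}+a_{k-1}x_k$ is right unimodular. For an integer $k\ge1$, $\Lambda\mathrm{sr}(\eta_1;R,\Delta)\le k-1$ means that $\mathrm{sr}(R_1)\le k-1$ and that for all $x_1,\dots,x_k\in R_1$ and $x_{-1},\dots,x_{-k}\in R_{-1,1}$ for which there are $y_1,\dots,y_k\in R_1$ and $y_{-1},\dots,y_{-k}\in R_{1,-1}$ with $\sum_{0<|i|\le k}y_ix_i=e_1$, there are $a_{ij}\in R_{1,-1}$ ($1\le i\le k$, $-k\le j\le-1$) with $a_{ij}=-\overline{a_{-j,-i}}$ and $a_{i,-i}\in\Delta^{\mathrm{ev}}$ such that the sequence $x_i+\sum_{j=-k}^{-1}a_{ij}x_j$, $1\le i\le k$, is right unimodular in $R_1$. The number $\Lambda\mathrm{sr}(\eta_1;R,\Delta)\in\{0,1,\dots,\infty\}$ is the least $m\geq 0$ such that $\Lambda\mathrm{sr}(\eta_1;R,\Delta)\le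 m$ in this sense ($\infty$ if there is none). **Lemma.** Let $(R,\Delta)$ be a semi-local odd form ring with a free orthogonal hyperbolic family $\eta_1,\dots,\eta_n$ of rank $n\ge1$. Then $\Lambda\mathrm{sr}(\eta_1;R,\Delta)\le1$ (both as the condition above with $k=2$ and as an inequality for the number $\Lambda\mathrm{sr}$), and $\Lambda\mathrm{sr}(\eta_1;R,\Delta)=0$ if and only if $R_1=0$. -/

import Mathlib

/-- An odd form ring `(R, Δ)`: a (possibly non-unital) ring `R` with an involution `star`, and a
(possibly non-commutative, but additively written) group `Δ` with a right action of the
multiplicative semigroup of `R` by group endomorphisms, together with maps `φ`, `π`, `ρ`. -/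
structure OddFormRing (R Δ : Type*) [NonUnitalRing R] [StarRing R] [AddGroup Δ] where
  /-- the right action `u · x` -/
  act : Δ → R → Δ
  act_add_left : ∀ u v x, act (u + v) x = act u x + act v x
  act_mul : ∀ u x y, act u (x * y) = act (act u x) y
  φ : R → Δ
  π : Δ → R
  ρ : Δ → R
  π_add : ∀ u v, π (u + v) = π u + π v
  π_act : ∀ u x, π (act u x) = π u * x
  φ_add : ∀ x y, φ (x + y) = φ x + φ y
  φ_conj : ∀ x y, φ (star x * y * x) = act (φ y) x
  φ_hermitian : ∀ x, star x = x → φ x = 0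
  add_φ_comm : ∀ u x, u + φ x = φ x + u
  add_swap : ∀ u v, u + v = v + u + φ (-(star (π u) * π v))
  ρ_add : ∀ u v, ρ (u + v) = ρ u - star (π u) * π v + ρ v
  star_ρ : ∀ u, star (ρ u) = ρ (-u)
  ρ_act : ∀ u x, ρ (act u x) = star x * ρ u * x
  π_φ : ∀ x, π (φ x) = 0
  ρ_φ : ∀ x, ρ (φ x) = x - star x
  act_add_right : ∀ u x y, act u (x + y) = act u x + φ (star y * ρ u * x) + act u y

/-- `a R b`, as a set. For idempotents `a`, `b` this is the Peirce component of `R`. -/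
def peirceComponent {R : Type*} [NonUnitalRing R] (a b : R) : Set R :=
  {z | ∃ r, z = a * r * b}

namespace OddFormRing

variable {R Δ : Type*} [NonUnitalRing R] [StarRing R] [AddGroup Δ]

/-- A hyperbolic pair `η = (e₋, e₊, q₋, q₊)` in an odd form ring. -/
structure HyperbolicPair (O : OddFormRing R Δ) where
  em : R
  ep : R
  qm : Δ
  qp : Δ
  em_idem : em * em = em
  ep_idem : ep * ep = ep
  em_mul_ep : em * ep = 0
  ep_mul_em : ep * em = 0
  star_ep : star ep = em
  π_qm : O.π qm = em
  ρ_qm : O.ρ qm = 0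
  qm_act : O.act qm em = qm
  π_qp : O.π qp = ep
  ρ_qp : O.ρ qp = 0
  qp_act : O.act qp ep = qp

/-- The hermitian idempotent `e_{|η|} = e₋ + e₊` of a hyperbolic pair. -/
def HyperbolicPair.e {O : OddFormRing R Δ} (η : O.HyperbolicPair) : R := η.em + η.ep

/-- Hyperbolic pairs are orthogonal if their hermitian idempotents are. -/
def HyperbolicPair.Orthogonal {O : OddFormRing R Δ} (η θ : O.HyperbolicPair) : Prop :=
  η.e * θ.e = 0 ∧ θ.e * η.e = 0

/-- Morita equivalence of hyperbolic pairs: with `a = e_{|η|}` and `b = e_{|θ|}`,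
`aRbRa = aRa` and `bRaRb = bRb`, where `aRbRa` is the additive group spanned by the
products `a r b s a`. -/
def HyperbolicPair.MoritaEquivalent {O : OddFormRing R Δ} (η θ : O.HyperbolicPair) : Prop :=
  (AddSubgroup.closure {z | ∃ r s, z = η.e * r * θ.e * s * η.e} : Set R) = peirceComponent η.e η.e ∧
  (AddSubgroup.closure {z | ∃ r s, z = θ.e * r * η.e * s * θ.e} : Set R) = peirceComponent θ.e θ.e

/-- An orthogonal hyperbolic family of rank `n`: pairwise orthogonal, pairwise Morita equivalent
hyperbolic pairs `η₁, …, ηₙ` (indexed here by `Fin n`, so starting with the index `0`). -/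
structure HyperbolicFamily (O : OddFormRing R Δ) (n : ℕ) where
  η : Fin n → O.HyperbolicPair
  orthogonal : ∀ i j, i ≠ j → (η i).Orthogonal (η j)
  morita : ∀ i j, i ≠ j → (η i).MoritaEquivalent (η j)

namespace HyperbolicFamily

variable {O : OddFormRing R Δ} {n : ℕ}

/-- The family is free: its members are coherently isomorphic, by elements `e i j ∈ eᵢ R eⱼ` with
`e i i = eᵢ` and `e i j * e j k = e i k`. -/
def IsFree (F : O.HyperbolicFamily n) : Prop :=
  ∃ e : Fin n → Fin n → R, (∀ i, e i i = (F.η i).ep) ∧ ∀ i j k, e i j * e j k = e i k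

/-- `e_{0'} = ∑ᵢ e_{|i|}`, the sum of all the idempotents of the family. -/
def eEven (F : O.HyperbolicFamily n) : R := ∑ i, (F.η i).e

/-- The even form parameter `Δᵉᵛ = ρ(Ker(π|_{Δ · e_{0'}}))`. -/
def evenFormParameter (F : O.HyperbolicFamily n) : Set R :=
  {z | ∃ u : Δ, (∃ v : Δ, u = O.act v F.eEven) ∧ O.π u = 0 ∧ z = O.ρ u}

end HyperbolicFamily

end OddFormRing

/-- For an idempotent `e` of `R`: a sequence `x` in the ring `e R e` (whose identity is `e`) is
right unimodular, that is `∑ᵢ yᵢ xᵢ = e` for some `yᵢ ∈ e R e`. -/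
def RightUnimodular {R : Type*} [NonUnitalRing R] (e : R) {k : ℕ} (x : Fin k → R) : Prop :=
  ∃ y : Fin k → R, (∀ i, y i ∈ peirceComponent e e) ∧ ∑ i, y i * x i = e

/-- `sr(e R e) ≤ m`, for an idempotent `e` of `R`. -/
def StableRankLE {R : Type*} [NonUnitalRing R] (e : R) (m : ℕ) : Prop :=
  ∀ x : Fin (m + 1) → R, (∀ i, x i ∈ peirceComponent e e) → RightUnimodular e x →
    ∃ a : Fin m → R, (∀ i, a i ∈ peirceComponent e e) ∧
      RightUnimodular e (fun i : Fin m => x i.castSucc + a i * x (Fin.last m))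

namespace OddFormRing.HyperbolicFamily

variable {R Δ : Type*} [NonUnitalRing R] [StarRing R] [AddGroup Δ] {O : OddFormRing R Δ} {n : ℕ}

/-- `Λsr(η; R, Δ) ≤ m`, where `η` is the member of the family with index `t`. With `k = m + 1` and
`e = e₊(η)`, `e' = e₋(η)`, the sequence `x₋ₖ, …, x₋₁, x₁, …, xₖ` is given by
`xp i = xᵢ ∈ e R e` and `xm i = x₋ᵢ ∈ e' R e`, the coefficients by `yp i = yᵢ ∈ e R e` and
`ym i = y₋ᵢ ∈ e R e'`, and the matrix by `a i j = a_{i,-j} ∈ e R e'`. -/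
def LambdaStableRankLE (F : O.HyperbolicFamily n) (t : Fin n) (m : ℕ) : Prop :=
  StableRankLE (F.η t).ep m ∧
  ∀ xm xp : Fin (m + 1) → R,
    (∀ i, xm i ∈ peirceComponent (F.η t).em (F.η t).ep) →
    (∀ i, xp i ∈ peirceComponent (F.η t).ep (F.η t).ep) →
    (∃ ym yp : Fin (m + 1) → R,
      (∀ i, ym i ∈ peirceComponent (F.η t).ep (F.η t).em) ∧
      (∀ i, yp i ∈ peirceComponent (F.η t).ep (F.η t).ep) ∧
      ∑ i, ym i * xm i + ∑ i, yp i * xp i = (F.η t).ep) →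
    ∃ a : Fin (m + 1) → Fin (m + 1) → R,
      (∀ i j, a i j ∈ peirceComponent (F.η t).ep (F.η t).em) ∧
      (∀ i j, a i j = -star (a j i)) ∧
      (∀ i, a i i ∈ F.evenFormParameter) ∧
      RightUnimodular (F.η t).ep (fun i => xp i + ∑ j, a i j * xm j)

/-- The number `Λsr(η; R, Δ) ∈ {0, 1, …, ∞}`: the least `m` with `Λsr(η; R, Δ) ≤ m`, and `∞` if
there is none. -/
noncomputable def lambdaStableRank (F : O.HyperbolicFamily n) (t : Fin n) : ℕ∞ :=
  sInf {N : ℕ∞ | ∃ m : ℕ, N = (m : ℕ∞) ∧ F.LambdaStableRankLE t m}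

end OddFormRing.HyperbolicFamily

/-- A unital ring is semi-local if its quotient by the Jacobson radical is isomorphic to a finite
product of matrix rings over division rings. -/
def IsSemilocal.{u} (R : Type u) [Ring R] : Prop :=
  ∃ (N : ℕ) (D : Fin N → Type u) (d : Fin N → ℕ) (_ : ∀ i, DivisionRing (D i)),
    (∀ i, d i ≠ 0) ∧
      Nonempty ((R ⧸ Ring.jacobson R) ≃+* ∀ i, Matrix (Fin (d i)) (Fin (d i)) (D i))

/-- An odd form ring `(R, Δ)` is semi-local if `R` is a unital semi-local ring. -/
def OddFormRing.IsSemilocal {R Δ : Type*} [Ring R] [StarRing R] [AddGroup Δ]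
    (_O : OddFormRing R Δ) : Prop :=
  _root_.IsSemilocal R

/-! The Jacobson radical is stable under the involution, so everything can be tested over the
semisimple quotient `S` of `R`: a combination congruent to `e` modulo the radical can be corrected
to equal `e` (`rightUnimodular_of_sub_mem_jacobson`).

For the form part, the involution turns columns into rows. With `p = star e`, a relation `∑ Yᵢ yᵢ +
∑ Xᵢ zᵢ = p` is given, and `X` is to be changed by `Y (b - b*)` until it is unimodular. By splitting
of semisimple modules, `X` is unimodular as soon as `s ↦ s • X` is injective on `S p`
(`exists_sum_mul_eq`). If it is not injective, its kernel contains a primitive idempotent `d`.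
Taking `b = H* G` for rows `H`, `G` changes `X` to `X + α • G - β • H`; the given relation lets `H`
be chosen with `d * α = d`, and if `H`, `G` are in general position with respect to `S X`, the
length of `S X` grows (`length_span_lt_length_span`). A length count inside `S²` shows that two
coordinates leave enough room for such `H` and `G`. Since `S²` has finite length, the process stops.

Only matrices `c* - c` are used. Their diagonal entries have the form `w - star w = ρ (φ w)`, hence
lie in every even form parameter. The stable rank bound is the analogous argument with the left
ideal `S x₁` growing, and the value zero is read off from unimodularity of the empty sequence. -/

/-! ### Lengths of submodules. -/

section Length

variable {S M P : Type*} [Ring S] [AddCommGroup M] [Module S M] [AddCommGroup P] [Module S P]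

theorem Submodule.length_map_add_length_inf_ker (f : M →ₗ[S] P) (A : Submodule S M) :
    Module.length S (A.map f) + Module.length S ↥(A ⊓ LinearMap.ker f) = Module.length S A := by
  rw [add_comm, Module.length_eq_add_of_exact
    (Submodule.inclusion (inf_le_left : A ⊓ LinearMap.ker f ≤ A)) (f.submoduleMap A)
    (Submodule.inclusion_injective _) (f.submoduleMap_surjective A)]
  rintro ⟨x, hx⟩
  constructor
  · intro h
    exact ⟨⟨x, hx, congrArg Subtype.val h⟩, rfl⟩
  · rintro ⟨⟨y, hy⟩, h⟩
    obtain rfl : y = x := congrArg Subtype.val h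
    exact Subtype.ext hy.2

/-- `A` and `A ⊔ B` have the same image in `M / B`, with kernels `A ⊓ B` and `B`. Keeping the
formula additive avoids subtraction of possibly infinite lengths. -/
theorem Submodule.length_sup_add_length_inf (A B : Submodule S M) :
    Module.length S ↥(A ⊔ B) + Module.length S ↥(A ⊓ B) =
      Module.length S A + Module.length S B := by
  have h1 := Submodule.length_map_add_length_inf_ker B.mkQ A
  have h2 := Submodule.length_map_add_length_inf_ker B.mkQ (A ⊔ B)
  have h3 : (A ⊔ B) ⊓ LinearMap.ker B.mkQ = B := by simp
  have h4 : (A ⊔ B).map B.mkQ = A.map B.mkQ := by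
    rw [Submodule.map_sup, Submodule.mkQ_map_self, sup_bot_eq]
  rw [h3, h4] at h2
  rw [Submodule.ker_mkQ] at h1
  rw [← h1, ← h2]
  ac_rfl

theorem Submodule.length_sup_le (A B : Submodule S M) :
    Module.length S ↥(A ⊔ B) ≤ Module.length S A + Module.length S B := by
  rw [← Submodule.length_sup_add_length_inf]
  exact le_self_add

theorem Submodule.length_mono {A B : Submodule S M} (h : A ≤ B) :
    Module.length S A ≤ Module.length S B :=
  Module.length_le_of_injective (Submodule.inclusion h) (Submodule.inclusion_injective h)

theorem Submodule.length_map_le (f : M →ₗ[S] P) (A : Submodule S M) :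
    Module.length S (A.map f) ≤ Module.length S A := by
  rw [← Submodule.length_map_add_length_inf_ker f A]
  exact le_self_add

theorem Submodule.one_le_length {A : Submodule S M} {x : M} (hx : x ∈ A) (h0 : x ≠ 0) :
    1 ≤ Module.length S A := by
  rw [Order.one_le_iff_ne_zero, Ne, Module.length_eq_zero_iff]
  intro h
  exact h0 (congrArg Subtype.val (h.elim ⟨x, hx⟩ 0))

theorem Submodule.span_singleton_eq_map_toSpanSingleton {d : S} {G : M} (h : d • G = G) :
    Submodule.span S {G} =
      (Submodule.span S {d}).map (LinearMap.toSpanSingleton S M G) := by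
  rw [Submodule.map_span, Set.image_singleton, LinearMap.toSpanSingleton_apply, h]

/-- A submodule generated by an element `G = d • G` with `S d` simple meets any submodule
not containing `G` trivially. -/
theorem Submodule.span_singleton_inf_eq_bot {d : S} (hd : IsSimpleModule S (Submodule.span S {d}))
    {G : M} (h : d • G = G) {W : Submodule S M} (hG : G ∉ W) :
    Submodule.span S {G} ⊓ W = ⊥ := by
  rw [eq_bot_iff]
  rintro x ⟨hx, hxW⟩
  by_contra hx0
  obtain ⟨s, rfl⟩ := Submodule.mem_span_singleton.mp hx
  let f := LinearMap.toSpanSingleton S (Submodule.span S {d})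
    (⟨s * d, Submodule.smul_mem _ s (Submodule.mem_span_singleton_self d)⟩ :
      Submodule.span S {d})
  have hne : (⟨s * d, Submodule.smul_mem _ s (Submodule.mem_span_singleton_self d)⟩ :
      Submodule.span S {d}) ≠ 0 := by
    intro h0
    apply hx0
    have : s * d = 0 := congrArg Subtype.val h0
    rw [Submodule.mem_bot, ← h, smul_smul, this, zero_smul]
  obtain ⟨t, ht⟩ := IsSimpleModule.toSpanSingleton_surjective S hne
    ⟨d, Submodule.mem_span_singleton_self d⟩
  have ht' : t * (s * d) = d := congrArg Subtype.val ht
  apply hG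
  have : t • s • G = G := by
    conv_rhs => rw [← h, ← ht']
    rw [mul_smul, mul_smul, h]
  rw [← this]
  exact W.smul_mem t hxW

end Length

/-! ### Primitive idempotents in semisimple rings. -/

section Semisimple

variable {S : Type*} [Ring S] [IsSemisimpleRing S]

/-- Von Neumann regularity: `S d = S e` for an idempotent `e = s * d`, which acts as a right
identity on `d`. -/
theorem IsSemisimpleRing.exists_mul_mul_eq (d : S) : ∃ s, d * s * d = d := by
  obtain ⟨e, he, h⟩ := IsSemisimpleRing.ideal_eq_span_idempotent (Ideal.span {d})
  obtain ⟨s, hs⟩ := Ideal.mem_span_singleton'.mp (h ▸ Ideal.mem_span_singleton_self e)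
  obtain ⟨t, ht⟩ := Ideal.mem_span_singleton'.mp (h ▸ Ideal.mem_span_singleton_self d)
  refine ⟨s, ?_⟩
  rw [mul_assoc, hs, ← ht, mul_assoc, he.eq]

/-- A nonzero left ideal contained in `S p` contains a primitive idempotent of `p S p`. -/
theorem IsSemisimpleRing.exists_primitive_idempotent {p : S} (hpp : p * p = p)
    {I : Submodule S S} (hI : I ≠ ⊥) (hp : ∀ x ∈ I, x * p = x) :
    ∃ d ∈ I, d * d = d ∧ p * d = d ∧ d * p = d ∧ IsSimpleModule S (Submodule.span S {d}) := by
  obtain ⟨I', hI', hs⟩ := (IsSemisimpleModule.eq_bot_or_exists_simple_le I).resolve_left hI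
  obtain ⟨c, hc, h⟩ := IsSemisimpleRing.ideal_eq_span_idempotent I'
  have hcI : c ∈ I' := h ▸ Ideal.mem_span_singleton_self c
  have hcp : c * p = c := hp c (hI' hcI)
  -- The generator `c` need not satisfy `p * c = c`; replacing it by `p * c` keeps the ideal because
  -- `c * (p * c) = c`.
  have key : Submodule.span S {p * c} = I' := by
    apply le_antisymm
    · rw [Submodule.span_singleton_le_iff_mem]
      exact I'.smul_mem p hcI
    · rw [h]
      refine (Submodule.span_singleton_le_iff_mem _ _).mpr
        (Submodule.mem_span_singleton.mpr ⟨c, ?_⟩)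
      rw [smul_eq_mul, ← mul_assoc, hcp, hc.eq]
  refine ⟨p * c, I.smul_mem p (hI' hcI), ?_, ?_, ?_, key ▸ hs⟩
  · rw [mul_assoc, ← mul_assoc c, hcp, hc.eq]
  · rw [← mul_assoc, hpp]
  · rw [mul_assoc, hcp]

/-- For `s` with `d * s * d = d`, the element `d * s * c` is a nonzero idempotent of `c S c`. It
generates the simple module `S c`, which forces it to equal `c`. -/
theorem IsSemisimpleRing.exists_mul_eq_of_isSimpleModule {c d : S} (hc : c * c = c)
    (hs : IsSimpleModule S (Submodule.span S {c})) (hd : d ≠ 0) (hcd : c * d = d) :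
    ∃ u, u * c = u ∧ d * u = c := by
  obtain ⟨s, hs'⟩ := IsSemisimpleRing.exists_mul_mul_eq d
  have hA : d * s * c * (d * s * c) = d * s * c := by
    calc d * s * c * (d * s * c) = d * s * (c * d) * s * c := by noncomm_ring
      _ = _ := by rw [hcd, hs']
  have hA0 : d * s * c ≠ 0 := by
    intro h
    apply hd
    calc d = d * s * (c * d) := by rw [hcd, hs']
      _ = d * s * c * d := by noncomm_ring
      _ = 0 := by rw [h, zero_mul]
  have hmem : d * s * c ∈ Submodule.span S {c} :=
    Submodule.smul_mem _ _ (Submodule.mem_span_singleton_self c)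
  have hne : (⟨_, hmem⟩ : Submodule.span S {c}) ≠ 0 := fun h => hA0 (congrArg Subtype.val h)
  obtain ⟨t, ht⟩ := IsSimpleModule.toSpanSingleton_surjective S hne
    ⟨c, Submodule.mem_span_singleton_self c⟩
  have ht' : t * (d * s * c) = c := congrArg Subtype.val ht
  refine ⟨s * c, by rw [mul_assoc, hc], ?_⟩
  rw [← mul_assoc]
  calc d * s * c = c * d * s * c := by rw [hcd]
    _ = c * (d * s * c) := by noncomm_ring
    _ = t * (d * s * c) * (d * s * c) := by rw [ht']
    _ = t * (d * s * c * (d * s * c)) := by noncomm_ring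
    _ = c := by rw [hA, ht']

/-- Primitivity is left-right symmetric: nonzero elements of `c S` can be multiplied on the right to
give `c`, and the involution carries this to `S (star c)`. -/
theorem IsSemisimpleRing.isSimpleModule_span_star [StarRing S] {c : S} (hc : c * c = c)
    (hs : IsSimpleModule S (Submodule.span S {c})) :
    IsSimpleModule S (Submodule.span S {star c}) := by
  have hc0 : c ≠ 0 := by
    rintro rfl
    have := hs.nontrivial
    rw [Submodule.span_zero_singleton] at this
    exact not_subsingleton _ (inferInstance : Subsingleton (⊥ : Submodule S S))
  rw [isSimpleModule_iff_toSpanSingleton_surjective]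
  constructor
  · refine ⟨⟨_, Submodule.mem_span_singleton_self _⟩, 0, fun h => hc0 ?_⟩
    exact star_eq_zero.mp (congrArg Subtype.val h)
  · rintro ⟨x, hx⟩ hx0 ⟨y, hy⟩
    obtain ⟨s, rfl⟩ := Submodule.mem_span_singleton.mp hx
    obtain ⟨t, rfl⟩ := Submodule.mem_span_singleton.mp hy
    have h0 : s * star c ≠ 0 := fun h => hx0 (Subtype.ext h)
    obtain ⟨u, -, hu⟩ := IsSemisimpleRing.exists_mul_eq_of_isSimpleModule (d := star (s * star c))
      hc hs (star_ne_zero.mpr h0) (by rw [star_mul, star_star, ← mul_assoc, hc])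
    refine ⟨t * star u, Subtype.ext ?_⟩
    have := congrArg star hu
    rw [star_mul, star_star] at this
    change t * star u * (s * star c) = t * star c
    rw [mul_assoc, this]

end Semisimple

/-! ### General position and growth of length for rows of two entries. -/

section Core

variable {S : Type*} [Ring S]

/-- The left ideal `S d S p` generated by `d S p`. -/
def isotypicIdeal (d p : S) : Submodule S S := Submodule.span S (Set.range fun t => d * t * p)

theorem mem_isotypicIdeal {d p t : S} (h : d * t = t) (h' : t * p = t) : t ∈ isotypicIdeal d p := by
  refine Submodule.subset_span ⟨t, ?_⟩
  change d * t * p = t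
  rw [h, h']

theorem pi_isotypicIdeal_le {d p : S} (hd : d * d = d) (hp : p * p = p) {X H : Fin 2 → S}
    (hX : p • X = X)
    (h : ∀ v : Fin 2 → S, d • v = v → (∀ j, v j * p = v j) →
      v ∈ Submodule.span S {X} ⊔ Submodule.span S {H}) :
    Submodule.pi Set.univ (fun _ : Fin 2 => isotypicIdeal d p) ≤
      (isotypicIdeal d p).map (LinearMap.toSpanSingleton S (Fin 2 → S) X) ⊔
        Submodule.span S {H} := by
  have key : ∀ (j : Fin 2) (n : S), n ∈ isotypicIdeal d p → (Pi.single j n : Fin 2 → S) ∈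
      (isotypicIdeal d p).map (LinearMap.toSpanSingleton S (Fin 2 → S) X) ⊔
        Submodule.span S {H} := by
    intro j n hn
    induction hn using Submodule.span_induction with
    | mem x hx =>
      obtain ⟨t, rfl⟩ := hx
      have hv : d • (Pi.single j (d * t * p) : Fin 2 → S) = Pi.single j (d * t * p) := by
        rw [← Pi.single_smul, smul_eq_mul, ← mul_assoc, ← mul_assoc, hd]
      have hm := h (Pi.single j (d * t * p)) hv (fun i => by
        by_cases hij : i = j
        · subst hij
          rw [Pi.single_eq_same, mul_assoc, hp]
        · rw [Pi.single_eq_of_ne hij, zero_mul])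
      -- Multiplying the decomposition by `d` turns the multiple `s • X` into `(d * s * p) • X`,
      -- whose coefficient lies in the isotypic ideal.
      obtain ⟨a, ha, b, hb, hab⟩ := Submodule.mem_sup.mp hm
      obtain ⟨s, rfl⟩ := Submodule.mem_span_singleton.mp ha
      change (Pi.single j (d * t * p) : Fin 2 → S) ∈ _
      rw [← hv, ← hab, smul_add]
      refine Submodule.add_mem_sup ⟨d * s * p, Submodule.subset_span ⟨s, rfl⟩, ?_⟩
        (Submodule.smul_mem _ _ hb)
      rw [LinearMap.toSpanSingleton_apply, mul_smul, hX, mul_smul]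
    | zero => simp
    | add x y _ _ hx hy => rw [Pi.single_add]; exact add_mem hx hy
    | smul s x _ hx => rw [Pi.single_smul]; exact Submodule.smul_mem _ s hx
  intro v hv
  have : v = ∑ j, Pi.single j (v j) := (Finset.univ_sum_single v).symm
  rw [this]
  exact Submodule.sum_mem _ fun j _ => key j _ (hv j trivial)

theorem two_mul_length_isotypicIdeal_le {d p : S} (hd : d * d = d) (hp : p * p = p)
    {X H : Fin 2 → S} (hX : p • X = X)
    (h : ∀ v : Fin 2 → S, d • v = v → (∀ j, v j * p = v j) →
      v ∈ Submodule.span S {X} ⊔ Submodule.span S {H}) :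
    2 * Module.length S (isotypicIdeal d p) ≤
      Module.length S ((isotypicIdeal d p).map (LinearMap.toSpanSingleton S (Fin 2 → S) X)) +
        Module.length S (Submodule.span S {H}) := by
  refine le_trans ?_ ((Submodule.length_mono (pi_isotypicIdeal_le hd hp hX h)).trans
    (Submodule.length_sup_le _ _))
  have h2 : Module.length S (Fin 2 → isotypicIdeal d p) =
      2 * Module.length S (isotypicIdeal d p) := by simp
  rw [← h2]
  let f : (Fin 2 → isotypicIdeal d p) →ₗ[S] (Fin 2 → S) :=
    LinearMap.pi fun j => (isotypicIdeal d p).subtype ∘ₗ LinearMap.proj j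
  refine Module.length_le_of_injective
    (f.codRestrict (Submodule.pi Set.univ fun _ => isotypicIdeal d p) fun v j _ => (v j).2) ?_
  intro v w hvw
  funext j
  exact Subtype.ext (congrFun (congrArg Subtype.val hvw) j)

/-- With `N = isotypicIdeal d p` nonzero, `N²` has length twice that of `N`, whereas `N X` is an
image of `N` and so too short to contain it. -/
theorem exists_notMem_span [IsSemisimpleRing S] {d p : S} (hd : d * d = d) (hp : p * p = p)
    {X : Fin 2 → S} (hX : p • X = X) {t : S} (ht : d * t * p ≠ 0) :
    ∃ v : Fin 2 → S, d • v = v ∧ (∀ j, v j * p = v j) ∧ v ∉ Submodule.span S {X} := by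
  by_contra! hcon
  have h := two_mul_length_isotypicIdeal_le (H := 0) hd hp hX fun v h1 h2 =>
    Submodule.mem_sup_left (hcon v h1 h2)
  have h1 := Submodule.length_map_le (LinearMap.toSpanSingleton S (Fin 2 → S) X)
    (isotypicIdeal d p)
  have h2 := Submodule.one_le_length (A := isotypicIdeal d p) (Submodule.subset_span ⟨t, rfl⟩) ht
  rw [Submodule.span_zero_singleton, Module.length_bot, add_zero] at h
  have h3 := h.trans h1
  obtain ⟨a, ha⟩ := ENat.ne_top_iff_exists.mp (Module.length_ne_top (R := S)
    (M := isotypicIdeal d p))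
  rw [← ha] at h3 h2
  norm_cast at h3 h2
  omega

/-- Since `d` lies in `N = isotypicIdeal d p` and kills `X`, the image `N X` is shorter than `N` by
at least one. This compensates for the length at most one of `S H`, so `N X + S H` still cannot
contain `N²`. -/
theorem exists_notMem_span_sup_span [IsSemisimpleRing S] {d p : S} (hd : d * d = d) (hp : p * p = p) (hd0 : d ≠ 0)
    (hdp : d * p = d)
    {X H : Fin 2 → S} (hX : p • X = X) (hdX : d • X = 0)
    (hH : Module.length S (Submodule.span S {H}) ≤ 1) :
    ∃ v : Fin 2 → S, d • v = v ∧ (∀ j, v j * p = v j) ∧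
      v ∉ Submodule.span S {X} ⊔ Submodule.span S {H} := by
  by_contra! hcon
  have h := two_mul_length_isotypicIdeal_le hd hp hX hcon
  have h1 := Submodule.length_map_add_length_inf_ker
    (LinearMap.toSpanSingleton S (Fin 2 → S) X) (isotypicIdeal d p)
  have h2 := Submodule.one_le_length
    (A := isotypicIdeal d p ⊓ LinearMap.ker (LinearMap.toSpanSingleton S (Fin 2 → S) X))
    (x := d) ⟨mem_isotypicIdeal hd hdp, by simpa using hdX⟩ hd0
  obtain ⟨a, ha⟩ := ENat.ne_top_iff_exists.mp (Module.length_ne_top (R := S)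
    (M := isotypicIdeal d p))
  obtain ⟨b, hb⟩ := ENat.ne_top_iff_exists.mp (Module.length_ne_top (R := S)
    (M := (isotypicIdeal d p).map (LinearMap.toSpanSingleton S (Fin 2 → S) X)))
  obtain ⟨c, hc⟩ := ENat.ne_top_iff_exists.mp (Module.length_ne_top (R := S)
    (M := ↥(isotypicIdeal d p ⊓ LinearMap.ker (LinearMap.toSpanSingleton S (Fin 2 → S) X))))
  obtain ⟨g, hg⟩ := ENat.ne_top_iff_exists.mp (Module.length_ne_top (R := S)
    (M := Submodule.span S {H}))
  rw [← ha, ← hb, ← hg] at h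
  rw [← ha, ← hb, ← hc] at h1
  rw [← hc] at h2
  rw [← hg] at hH
  norm_cast at h h1 h2 hH
  omega

/-- Perturbing a vector `X` by `α G` and `β H`, for `G` and `H` in general position with
respect to `S X`, increases the length of the submodule it generates. -/
theorem length_span_lt_length_span [IsSemisimpleRing S] {d d' : S} (hd : IsSimpleModule S (Submodule.span S {d}))
    (hd' : IsSimpleModule S (Submodule.span S {d'})) {X G H : Fin 2 → S}
    (hdX : d • X = 0) (hG : d • G = G) (hH : d' • H = H)
    (hHX : H ∉ Submodule.span S {X})
    (hGX : G ∉ Submodule.span S {X} ⊔ Submodule.span S {H}) {α β : S} (hα : d * α = d) :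
    Module.length S (Submodule.span S {X}) <
      Module.length S (Submodule.span S {X + α • G - β • H}) := by
  set V := Submodule.span S {X}
  set Q := Submodule.span S {G} ⊔ Submodule.span S {H} with hQ
  set U := X + α • G - β • H with hU
  set T := Submodule.span S {U}
  have hVQ : V ⊓ Q = ⊥ := by
    have h1 := Submodule.span_singleton_inf_eq_bot hd' hH hHX
    have h2 := Submodule.span_singleton_inf_eq_bot hd hG hGX
    rw [eq_bot_iff]
    rintro x ⟨hxV, hxQ⟩
    obtain ⟨g, hg, k, hk, rfl⟩ := Submodule.mem_sup.mp hxQ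
    have hg0 : g ∈ Submodule.span S {G} ⊓ (V ⊔ Submodule.span S {H}) := by
      refine ⟨hg, ?_⟩
      have := Submodule.sub_mem _ (SetLike.le_def.mp (le_sup_left : V ≤ V ⊔ Submodule.span S {H}) hxV)
        (SetLike.le_def.mp (le_sup_right : _ ≤ V ⊔ Submodule.span S {H}) hk)
      simpa using this
    rw [h2, Submodule.mem_bot] at hg0
    subst hg0
    rw [zero_add] at hxV ⊢
    rw [← h1]
    exact ⟨hk, hxV⟩
  have hGQ : G ∈ Q := Submodule.mem_sup_left (Submodule.mem_span_singleton_self G)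
  have hHQ : H ∈ Q := Submodule.mem_sup_right (Submodule.mem_span_singleton_self H)
  have hTQ : T ⊔ Q = V ⊔ Q := by
    apply le_antisymm
    · refine sup_le ((Submodule.span_singleton_le_iff_mem _ _).mpr ?_) le_sup_right
      rw [hU, add_sub_assoc]
      exact Submodule.add_mem_sup (Submodule.mem_span_singleton_self X)
        (Q.sub_mem (Q.smul_mem _ hGQ) (Q.smul_mem _ hHQ))
    · refine sup_le ((Submodule.span_singleton_le_iff_mem _ _).mpr ?_) le_sup_right
      have : X = U + (β • H - α • G) := by rw [hU]; abel
      rw [this]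
      exact Submodule.add_mem_sup (Submodule.mem_span_singleton_self U)
        (Q.sub_mem (Q.smul_mem _ hHQ) (Q.smul_mem _ hGQ))
  have hdU : d • U = G - (d * β) • H := by
    rw [hU, smul_sub, smul_add, hdX, zero_add, smul_smul, hα, hG, smul_smul]
  -- `V` and `T` have the same sum with `Q`, and `V` meets `Q` trivially, so the gain in length is
  -- exactly that of `T ⊓ Q`. As `d` kills `X`, this intersection contains `d • U`, which is nonzero
  -- because `G` is not in `S H`.
  have hpos : 1 ≤ Module.length S ↥(T ⊓ Q) := by
    refine Submodule.one_le_length (x := d • U)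
      ⟨T.smul_mem _ (Submodule.mem_span_singleton_self U), ?_⟩ ?_
    · rw [hdU]
      exact Q.sub_mem hGQ (Q.smul_mem _ hHQ)
    · rw [hdU, sub_ne_zero]
      intro h
      apply hGX
      rw [h]
      exact Submodule.mem_sup_right
        (Submodule.smul_mem _ _ (Submodule.mem_span_singleton_self H))
  have h1 := Submodule.length_sup_add_length_inf V Q
  have h2 := Submodule.length_sup_add_length_inf T Q
  rw [hVQ, Module.length_bot, add_zero] at h1
  rw [hTQ, h1] at h2
  obtain ⟨a, ha⟩ := ENat.ne_top_iff_exists.mp (Module.length_ne_top (R := S) (M := V))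
  obtain ⟨b, hb⟩ := ENat.ne_top_iff_exists.mp (Module.length_ne_top (R := S) (M := Q))
  obtain ⟨c, hc⟩ := ENat.ne_top_iff_exists.mp (Module.length_ne_top (R := S) (M := ↥(T ⊓ Q)))
  obtain ⟨g, hg⟩ := ENat.ne_top_iff_exists.mp (Module.length_ne_top (R := S) (M := T))
  rw [← ha, ← hb, ← hc, ← hg] at h2
  rw [← hc] at hpos
  rw [← ha, ← hg]
  norm_cast at h2 hpos ⊢
  omega

/-- The embedding `s ↦ s • X` of `S p` into `S²` splits by semisimplicity. The splitting is right
multiplication by a column, and cutting that column down by `p` on both sides gives `z`. -/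
theorem exists_sum_mul_eq [IsSemisimpleRing S] {p : S} (hp : p * p = p) {X : Fin 2 → S} (hX : p • X = X)
    (hXp : ∀ j, X j * p = X j) (hker : ∀ k, k * p = k → k • X = 0 → k = 0) :
    ∃ z : Fin 2 → S, (∀ j, p * z j = z j ∧ z j * p = z j) ∧ ∑ j, X j * z j = p := by
  let f : Submodule.span S {p} →ₗ[S] (Fin 2 → S) :=
    LinearMap.toSpanSingleton S (Fin 2 → S) X ∘ₗ (Submodule.span S {p}).subtype
  have hf : Function.Injective f := by
    rw [injective_iff_map_eq_zero]
    rintro ⟨k, hk⟩ h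
    obtain ⟨s, rfl⟩ := Submodule.mem_span_singleton.mp hk
    exact Subtype.ext (hker (s * p) (by rw [mul_assoc, hp]) h)
  obtain ⟨h, hh⟩ := IsSemisimpleModule.extension_property f hf (Submodule.span S {p}).subtype
  have hhX : h X = p := by
    have := LinearMap.congr_fun hh ⟨p, Submodule.mem_span_singleton_self p⟩
    change h (p • X) = p at this
    rwa [hX] at this
  refine ⟨fun j => p * h (Pi.single j 1) * p, fun j => ⟨?_, ?_⟩, ?_⟩
  · rw [← mul_assoc, ← mul_assoc, hp]
  · rw [mul_assoc, hp]
  · have h1 : h X = ∑ j, X j * h (Pi.single j 1) := by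
      conv_lhs => rw [← Finset.univ_sum_single X, map_sum]
      refine Finset.sum_congr rfl fun j _ => ?_
      rw [← smul_eq_mul, ← map_smul, ← Pi.single_smul, smul_eq_mul, mul_one]
    calc ∑ j, X j * (p * h (Pi.single j 1) * p)
        = (∑ j, X j * h (Pi.single j 1)) * p := by
          rw [Finset.sum_mul]
          refine Finset.sum_congr rfl fun j _ => ?_
          rw [← mul_assoc, ← mul_assoc, hXp]
      _ = p := by rw [← h1, hhX, hp]

end Core

/-! ### Unimodularity over a semisimple ring. -/

section Unimodular

variable {S : Type*} [Ring S] [IsSemisimpleRing S]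

theorem exists_perturbation_length_lt [StarRing S] {p : S} (hp : p * p = p) {X Y : Fin 2 → S}
    (hX : p • X = X) (hY : ∀ i, Y i * star p = Y i) {y z : Fin 2 → S}
    (hyz : ∑ i, Y i * y i + ∑ i, X i * z i = p)
    {k : S} (hk0 : k ≠ 0) (hkp : k * p = k) (hkX : k • X = 0) :
    ∃ b : Fin 2 → Fin 2 → S, (∀ i j, star p * b i j = b i j ∧ b i j * p = b i j) ∧
      Module.length S (Submodule.span S {X}) <
        Module.length S (Submodule.span S
          {fun j => X j + ∑ i, Y i * (b i j - star (b j i))}) := by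
  let I : Submodule S S :=
    Submodule.span S {p} ⊓ LinearMap.ker (LinearMap.toSpanSingleton S (Fin 2 → S) X)
  have hI : I ≠ ⊥ := by
    intro h
    have : k ∈ I := ⟨Submodule.mem_span_singleton.mpr ⟨k, hkp⟩, by simpa using hkX⟩
    rw [h, Submodule.mem_bot] at this
    exact hk0 this
  obtain ⟨d, hdI, hdd, hpd, hdp, hds⟩ :=
    IsSemisimpleRing.exists_primitive_idempotent hp hI fun x hx => by
      obtain ⟨s, rfl⟩ := Submodule.mem_span_singleton.mp hx.1
      rw [smul_eq_mul, mul_assoc, hp]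
  have hdX : d • X = 0 := by simpa using hdI.2
  have hdX' : ∀ i, d * X i = 0 := fun i => congrFun hdX i
  have hds' := IsSemisimpleRing.isSimpleModule_span_star hdd hds
  have hd0 : d ≠ 0 := by
    rintro rfl
    have := hds.nontrivial
    rw [Submodule.span_zero_singleton] at this
    exact not_subsingleton _ (inferInstance : Subsingleton (⊥ : Submodule S S))
  have hdd' : star d * star d = star d := by rw [← star_mul, hdd]
  have hw : ∑ i, d * Y i * y i = d := by
    have := congrArg (d * ·) hyz
    simp only [mul_add, Finset.mul_sum, ← mul_assoc, hdX', zero_mul, Finset.sum_const_zero,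
      add_zero, hdp] at this
    exact this
  -- The last condition is `d * α = d` for `α = ∑ Yᵢ star (Hᵢ)`. The natural candidate comes from
  -- the coefficients `y`, since `d` annihilates the `X`-part of the relation.
  have hH : ∃ H : Fin 2 → S, star d • H = H ∧ (∀ j, H j * p = H j) ∧
      H ∉ Submodule.span S {X} ∧ ∑ i, d * Y i * star (H i) = d := by
    set H₀ : Fin 2 → S := fun i => star d * star (y i) * p with hH₀
    have h1 : star d • H₀ = H₀ := by
      funext i
      simp only [hH₀, Pi.smul_apply, smul_eq_mul, ← mul_assoc, hdd']
    have h2 : ∀ j, H₀ j * p = H₀ j := fun j => by simp only [hH₀, mul_assoc, hp]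
    have h3 : ∑ i, d * Y i * star (H₀ i) = d := by
      calc ∑ i, d * Y i * star (H₀ i) = (∑ i, d * Y i * y i) * d := by
            rw [Finset.sum_mul]
            refine Finset.sum_congr rfl fun i _ => ?_
            simp only [hH₀, star_mul, star_star]
            calc d * Y i * (star p * (y i * d)) = d * (Y i * star p) * y i * d := by noncomm_ring
              _ = _ := by rw [hY]
        _ = d := by rw [hw, hdd]
    by_cases hV : H₀ ∈ Submodule.span S {X}
    · have ht : ∃ i, H₀ i ≠ 0 := by
        by_contra! h
        simp only [h, star_zero, mul_zero, Finset.sum_const_zero] at h3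
        exact hd0 h3.symm
      obtain ⟨i, hi⟩ := ht
      obtain ⟨v, hv1, hv2, hv3⟩ := exists_notMem_span hdd' hp hX hi
      set c := ∑ i, d * Y i * star (v i) with hc
      have hdc : d * c = c := by simp only [hc, Finset.mul_sum, ← mul_assoc, hdd]
      -- Adding `v` leaves `S X` but changes the normalization by `c`; subtracting `star c • H₀`,
      -- which lies in `S X`, restores it.
      refine ⟨H₀ + v - star c • H₀, ?_, ?_, ?_, ?_⟩
      · have hdc' : c * d = c := by
          have hv1' : ∀ i, star (v i) * d = star (v i) := fun i => by
            have := congrArg star (congrFun hv1 i)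
            simpa using this
          simp only [hc, Finset.sum_mul, mul_assoc, hv1']
        have : star d * star c = star c := by rw [← star_mul, hdc']
        rw [smul_sub, smul_add, h1, hv1, smul_smul, this]
      · intro j
        simp only [Pi.sub_apply, Pi.add_apply, Pi.smul_apply, smul_eq_mul, sub_mul, add_mul, h2,
          hv2, mul_assoc]
      · intro h
        apply hv3
        have := Submodule.add_mem _ (Submodule.sub_mem _ h hV) (Submodule.smul_mem _ (star c) hV)
        have e : H₀ + v - star c • H₀ - H₀ + star c • H₀ = v := by abel
        rwa [e] at this
      · simp only [Pi.sub_apply, Pi.add_apply, Pi.smul_apply, smul_eq_mul, star_sub, star_add,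
          star_mul, star_star, mul_sub, mul_add, Finset.sum_sub_distrib, Finset.sum_add_distrib,
          ← mul_assoc, h3]
        rw [← Finset.sum_mul, h3, ← hc, hdc, add_sub_cancel_right]
    · exact ⟨H₀, h1, h2, hV, h3⟩
  obtain ⟨H, hH1, hH2, hH3, hH4⟩ := hH
  have hHlen : Module.length S (Submodule.span S {H}) ≤ 1 := by
    rw [Submodule.span_singleton_eq_map_toSpanSingleton hH1]
    exact (Submodule.length_map_le _ _).trans (Module.length_eq_one S _).le
  obtain ⟨G, hG1, hG2, hG3⟩ := exists_notMem_span_sup_span hdd hp hd0 hdp hX hdX hHlen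
  have hpH : ∀ i, star p * star (H i) = star (H i) := fun i => by rw [← star_mul, hH2]
  -- For this rank-one `b`, the matrix `b - b*` moves `X` only along `G` and `H`.
  refine ⟨fun i j => star (H i) * G j, fun i j => ⟨by rw [← mul_assoc, hpH],
    by rw [mul_assoc, hG2]⟩, ?_⟩
  have hU : (fun j => X j + ∑ i, Y i * (star (H i) * G j - star (star (H j) * G i))) =
      X + (∑ i, Y i * star (H i)) • G - (∑ i, Y i * star (G i)) • H := by
    funext j
    simp only [Pi.sub_apply, Pi.add_apply, Pi.smul_apply, smul_eq_mul, star_mul, star_star,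
      mul_sub, Finset.sum_sub_distrib, Finset.sum_mul, mul_assoc, add_sub_assoc]
  rw [hU]
  refine length_span_lt_length_span hds hds' hdX hG1 hH1 hH3 hG3 ?_
  simpa only [Finset.mul_sum, mul_assoc] using hH4

theorem exists_perturbation_unimodular [StarRing S] {p : S} (hp : p * p = p)
    {X Y : Fin 2 → S} (hX : p • X = X) (hXp : ∀ j, X j * p = X j)
    (hpY : p • Y = Y) (hY : ∀ i, Y i * star p = Y i) {y z : Fin 2 → S}
    (hyz : ∑ i, Y i * y i + ∑ i, X i * z i = p) :
    ∃ b : Fin 2 → Fin 2 → S, (∀ i j, star p * b i j = b i j ∧ b i j * p = b i j) ∧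
      ∃ z : Fin 2 → S, (∀ j, p * z j = z j ∧ z j * p = z j) ∧
        ∑ j, (X j + ∑ i, Y i * (b i j - star (b j i))) * z j = p := by
  -- Induction on a bound `n` for the colength of `S X` in `S²`. The coefficients `z` stay fixed,
  -- while `y` must vary to absorb each perturbation.
  have key : ∀ (n : ℕ) (X y : Fin 2 → S), p • X = X → (∀ j, X j * p = X j) →
      ∑ i, Y i * y i + ∑ i, X i * z i = p →
      Module.length S (Fin 2 → S) ≤ Module.length S (Submodule.span S {X}) + n →
      ∃ b : Fin 2 → Fin 2 → S, (∀ i j, star p * b i j = b i j ∧ b i j * p = b i j) ∧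
        ∃ z : Fin 2 → S, (∀ j, p * z j = z j ∧ z j * p = z j) ∧
          ∑ j, (X j + ∑ i, Y i * (b i j - star (b j i))) * z j = p := by
    intro n
    induction n with
    | zero =>
      intro X y hX hXp hyz hn
      refine ⟨0, by simp, ?_⟩
      simp only [Pi.zero_apply, star_zero, sub_zero, mul_zero, Finset.sum_const_zero, add_zero]
      refine exists_sum_mul_eq hp hX hXp fun k hkp hkX => ?_
      by_contra hk0
      obtain ⟨b, -, hb⟩ := exists_perturbation_length_lt hp hX hY hyz hk0 hkp hkX
      rw [Nat.cast_zero, add_zero] at hn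
      refine absurd (hn.trans_lt hb) (not_lt.mpr ?_)
      exact Module.length_le_of_injective _ (Submodule.subtype_injective _)
    | succ n ih =>
      intro X y hX hXp hyz hn
      by_cases hker : ∀ k, k * p = k → k • X = 0 → k = 0
      · refine ⟨0, by simp, ?_⟩
        simp only [Pi.zero_apply, star_zero, sub_zero, mul_zero, Finset.sum_const_zero, add_zero]
        exact exists_sum_mul_eq hp hX hXp hker
      · push Not at hker
        obtain ⟨k, hkp, hkX, hk0⟩ := hker
        obtain ⟨b, hb, hlt⟩ := exists_perturbation_length_lt hp hX hY hyz hk0 hkp hkX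
        have hbs : ∀ i j, star (b i j) * p = star (b i j) := fun i j => by
          conv_rhs => rw [← (hb i j).1, star_mul, star_star]
        set X' : Fin 2 → S := fun j => X j + ∑ i, Y i * (b i j - star (b j i)) with hX'
        have h1 : ∀ j, p * X j = X j := fun j => congrFun hX j
        have h2 : ∀ j, p * Y j = Y j := fun j => congrFun hpY j
        have hpX' : p • X' = X' := by
          funext j
          simp only [hX', Pi.smul_apply, smul_eq_mul, mul_add, Finset.mul_sum, ← mul_assoc, h1, h2]
        have hX'p : ∀ j, X' j * p = X' j := fun j => by
          simp only [hX', add_mul, Finset.sum_mul, mul_assoc, sub_mul, hXp, (hb _ _).2, hbs]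
        have hyz' : ∑ i, Y i * (y i - ∑ j, (b i j - star (b j i)) * z j) +
            ∑ i, X' i * z i = p := by
          rw [← hyz]
          simp only [hX', Fin.sum_univ_two]
          noncomm_ring
        have hn' : Module.length S (Fin 2 → S) ≤
            Module.length S (Submodule.span S {X'}) + n := by
          refine hn.trans ?_
          rw [Nat.cast_add, Nat.cast_one, add_comm (n : ℕ∞), ← add_assoc]
          gcongr
          exact Order.add_one_le_of_lt hlt
        obtain ⟨b', hb', z', hz', h⟩ := ih X' _ hpX' hX'p hyz' hn'
        refine ⟨b + b', fun i j => ?_, z', hz', ?_⟩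
        · simp only [Pi.add_apply, mul_add, add_mul, (hb i j).1, (hb i j).2, (hb' i j).1,
            (hb' i j).2, and_self]
        · rw [← h]
          refine Finset.sum_congr rfl fun j _ => ?_
          rw [hX', add_assoc, ← Finset.sum_add_distrib]
          refine congrArg (fun t => (X j + t) * z' j) (Finset.sum_congr rfl fun i _ => ?_)
          simp only [Pi.add_apply, star_add]
          noncomm_ring
  obtain ⟨n, hn⟩ := ENat.ne_top_iff_exists.mp (Module.length_ne_top (R := S) (M := Fin 2 → S))
  exact key n X y hX hXp hyz (hn ▸ le_add_self)

/-- Some primitive `c` has `c * x₂` outside `S x₁`. Right multiplication by `x₁` on the isotypic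
ideal of `c` is then not surjective, hence not injective; a kernel element is used to choose `a` so
that `S (x₁ + a * x₂)` contains `c * x₂` and still contains `x₁`. -/
theorem exists_span_lt_span_add_mul {e : S} (he : e * e = e) {x₁ x₂ : S}
    (h₁ : x₁ * e = x₁) (he₂ : e * x₂ = x₂) (h₂ : x₂ * e = x₂)
    (hx₂ : x₂ ∉ Submodule.span S {x₁}) :
    ∃ a, e * a = a ∧ a * e = a ∧ Submodule.span S {x₁} < Submodule.span S {x₁ + a * x₂} := by
  obtain ⟨c, hcc, hec, hce, hcs, hcx⟩ : ∃ c, c * c = c ∧ e * c = c ∧ c * e = c ∧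
      IsSimpleModule S (Submodule.span S {c}) ∧ c * x₂ ∉ Submodule.span S {x₁} := by
    by_contra! hcon
    apply hx₂
    have hle : Submodule.span S {e} ≤
        (Submodule.span S {x₁}).comap (LinearMap.toSpanSingleton S S x₂) := by
      rw [← IsSemisimpleModule.sSup_simples_le (Submodule.span S {e})]
      refine sSup_le ?_
      rintro I ⟨hI, hIe⟩
      have hI0 : I ≠ ⊥ := by
        rintro rfl
        exact not_subsingleton_iff_nontrivial.mpr hI.nontrivial inferInstance
      obtain ⟨c, hcI, hcc, hec, hce, hcs⟩ :=
        IsSemisimpleRing.exists_primitive_idempotent he hI0 fun x hx => by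
          obtain ⟨s, rfl⟩ := Submodule.mem_span_singleton.mp (hIe hx)
          rw [smul_eq_mul, mul_assoc, he]
      have hc := hcon c hcc hec hce hcs
      intro x hx
      have hc0 : (⟨c, hcI⟩ : I) ≠ 0 := by
        intro h
        have hc0 : c = 0 := congrArg Subtype.val h
        rw [hc0, Submodule.span_zero_singleton] at hcs
        exact not_subsingleton_iff_nontrivial.mpr hcs.nontrivial inferInstance
      obtain ⟨t, ht⟩ := IsSimpleModule.toSpanSingleton_surjective S hc0 ⟨x, hx⟩
      have ht' : t * c = x := congrArg Subtype.val ht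
      change x * x₂ ∈ Submodule.span S {x₁}
      rw [← ht', mul_assoc]
      exact Submodule.smul_mem _ t hc
    have := hle (Submodule.mem_span_singleton_self e)
    change e * x₂ ∈ Submodule.span S {x₁} at this
    rwa [he₂] at this
  have hx₁ : ∀ n ∈ isotypicIdeal c e, LinearMap.toSpanSingleton S S x₁ n ∈ isotypicIdeal c e := by
    intro n hn
    induction hn using Submodule.span_induction with
    | mem n hn =>
      obtain ⟨t, rfl⟩ := hn
      refine Submodule.subset_span ⟨t * e * x₁, ?_⟩
      change c * (t * e * x₁) * e = c * t * e * x₁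
      rw [mul_assoc, mul_assoc (t * e), h₁, ← mul_assoc, ← mul_assoc]
    | zero => simp
    | add x y _ _ hx hy => rw [map_add]; exact add_mem hx hy
    | smul s x _ hx => rw [map_smul]; exact Submodule.smul_mem _ s hx
  obtain ⟨k, hkN, hk0, hkx⟩ : ∃ k ∈ isotypicIdeal c e, k ≠ 0 ∧ k * x₁ = 0 := by
    by_contra! hcon
    obtain ⟨⟨n, hn⟩, h⟩ := IsArtinian.surjective_of_injective_endomorphism
      ((LinearMap.toSpanSingleton S S x₁).restrict hx₁) (by
        rw [injective_iff_map_eq_zero]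
        rintro ⟨k, hk⟩ h
        by_contra hk0
        exact hcon k hk (fun h => hk0 (Subtype.ext h)) (congrArg Subtype.val h))
      ⟨c * x₂, mem_isotypicIdeal (by rw [← mul_assoc, hcc]) (by rw [mul_assoc, h₂])⟩
    have h' : n * x₁ = c * x₂ := congrArg Subtype.val h
    exact hcx (Submodule.mem_span_singleton.mpr ⟨n, h'⟩)
  -- Otherwise the whole isotypic ideal kills `S k` from the left, contradicting `k = k * (s * k)`
  -- with `k` in that ideal.
  obtain ⟨t, ht⟩ : ∃ t, c * t * k ≠ 0 := by
    by_contra! hcon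
    obtain ⟨s, hs⟩ := IsSemisimpleRing.exists_mul_mul_eq k
    have : ∀ n ∈ isotypicIdeal c e, n * (s * k) = 0 := by
      intro n hn
      induction hn using Submodule.span_induction with
      | mem n hn =>
        obtain ⟨t, rfl⟩ := hn
        change c * t * e * (s * k) = 0
        rw [← mul_assoc, mul_assoc c, mul_assoc c]
        exact hcon _
      | zero => rw [zero_mul]
      | add x y _ _ hx hy => rw [add_mul, hx, hy, add_zero]
      | smul r x _ hx => rw [smul_eq_mul, mul_assoc, hx, mul_zero]
    rw [← hs, mul_assoc] at hk0
    exact hk0 (this k hkN)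
  have hke : k * e = k := by
    clear hkx hk0 ht
    induction hkN using Submodule.span_induction with
    | mem n hn =>
      obtain ⟨t, rfl⟩ := hn
      change c * t * e * e = c * t * e
      rw [mul_assoc, he]
    | zero => rw [zero_mul]
    | add x y _ _ hx hy => rw [add_mul, hx, hy]
    | smul r x _ hx => rw [smul_eq_mul, mul_assoc, hx]
  obtain ⟨u, huc, hu⟩ := IsSemisimpleRing.exists_mul_eq_of_isSimpleModule hcc hcs ht
    (by rw [← mul_assoc, ← mul_assoc, hcc])
  have hmem : c * x₂ ∈ Submodule.span S {x₁ + e * u * x₂} := by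
    refine Submodule.mem_span_singleton.mpr ⟨c * t * k, ?_⟩
    calc c * t * k * (x₁ + e * u * x₂)
        = c * t * (k * x₁) + c * t * (k * e) * u * x₂ := by noncomm_ring
      _ = c * x₂ := by rw [hkx, hke, hu, mul_zero, zero_add]
  refine ⟨e * u, by rw [← mul_assoc, he], ?_, lt_of_le_of_ne ?_ ?_⟩
  · rw [mul_assoc]
    conv_lhs => rw [← huc, mul_assoc, hce, huc]
  · rw [Submodule.span_singleton_le_iff_mem]
    have h := Submodule.sub_mem _ (Submodule.mem_span_singleton_self (x₁ + e * u * x₂))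
      (Submodule.smul_mem _ (e * u) hmem)
    have e' : x₁ + e * u * x₂ - (e * u) • (c * x₂) = x₁ := by
      rw [smul_eq_mul, ← mul_assoc (e * u), mul_assoc e u c, huc, add_sub_cancel_right]
    rwa [e'] at h
  · intro h
    exact hcx (h ▸ hmem)

theorem exists_mul_add_mul_eq {e : S} (he : e * e = e) {x₁ x₂ : S}
    (he₁ : e * x₁ = x₁) (h₁ : x₁ * e = x₁) (he₂ : e * x₂ = x₂) (h₂ : x₂ * e = x₂) {y₁ y₂ : S}
    (h : y₁ * x₁ + y₂ * x₂ = e) :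
    ∃ a y, (e * a = a ∧ a * e = a) ∧ (e * y = y ∧ y * e = y) ∧ y * (x₁ + a * x₂) = e := by
  generalize hV : Submodule.span S {x₁} = V
  induction V using WellFoundedGT.induction generalizing x₁ y₂ with
  | ind V ih =>
    by_cases hx₂ : x₂ ∈ Submodule.span S {x₁}
    · obtain ⟨t, ht⟩ := Submodule.mem_span_singleton.mp hx₂
      refine ⟨0, e * (y₁ + y₂ * t) * e, by simp, ⟨?_, ?_⟩, ?_⟩
      · rw [← mul_assoc, ← mul_assoc, he]
      · rw [mul_assoc, he]
      · rw [zero_mul, add_zero, mul_assoc, he₁, mul_assoc, add_mul, mul_assoc, ← smul_eq_mul t,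
          ht, h, he]
    · obtain ⟨a, hea, hae, hlt⟩ := exists_span_lt_span_add_mul he h₁ he₂ h₂ hx₂
      -- Ascending induction on `S x₁`; the new `y₂` keeps the unimodularity relation valid.
      obtain ⟨a', y, ⟨h1, h2⟩, hy, h3⟩ := ih _ (hV ▸ hlt) (x₁ := x₁ + a * x₂) (y₂ := y₂ - y₁ * a)
        (by rw [mul_add, ← mul_assoc, he₁, hea]) (by rw [add_mul, mul_assoc, h₁, h₂])
        (by rw [← h]; noncomm_ring) rfl
      refine ⟨a + a', y, ⟨by rw [mul_add, hea, h1], by rw [add_mul, hae, h2]⟩, hy, ?_⟩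
      rw [add_mul, ← add_assoc, h3]

end Unimodular

/-! ### The involution on the quotient by the Jacobson radical. -/

section Jacobson

variable {R : Type*} [Ring R]

/-- A left inverse of `r` is again congruent to `1`, so it has a left inverse too, and this must be
`r`. -/
theorem Ring.isUnit_of_sub_one_mem_jacobson {r : R} (h : r - 1 ∈ Ring.jacobson R) : IsUnit r := by
  have left_inv : ∀ r : R, r - 1 ∈ Ring.jacobson R → ∃ s, s * r = 1 := fun r hr => by
    obtain ⟨s, hs⟩ := Ideal.exists_mul_sub_mem_of_sub_one_mem_jacobson (I := ⊥) r
      (by rwa [Ideal.jacobson_bot])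
    exact ⟨s, sub_eq_zero.mp hs⟩
  obtain ⟨s, hs⟩ := left_inv r h
  obtain ⟨t, ht⟩ := left_inv s (by
    have : s - 1 = -(s * (r - 1)) := by rw [mul_sub, hs, mul_one, neg_sub]
    rw [this]
    exact neg_mem (Ideal.mul_mem_left _ _ h))
  have htr : t = r := by rw [← mul_one t, ← hs, ← mul_assoc, ht, one_mul]
  exact ⟨⟨r, s, htr ▸ ht, hs⟩, rfl⟩

/-- The radical is two-sided and defined by invertibility of `1 + y * x`; the involution preserves
units. -/
theorem Ring.star_mem_jacobson [StarRing R] {x : R} (hx : x ∈ Ring.jacobson R) :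
    star x ∈ Ring.jacobson R := by
  rw [← Ideal.jacobson_bot, Ideal.mem_jacobson_iff]
  intro y
  have hu : IsUnit (1 + x * star y) := Ring.isUnit_of_sub_one_mem_jacobson (by
    rw [add_sub_cancel_left]
    exact Ideal.mul_mem_right _ _ hx)
  have hu' : IsUnit (1 + y * star x) := by
    have := hu.star
    rwa [star_add, star_one, star_mul, star_star] at this
  obtain ⟨z, hz⟩ := hu'.exists_left_inv
  refine ⟨z, ?_⟩
  have : z * y * star x + z - 1 = z * (1 + y * star x) - 1 := by noncomm_ring
  rw [this, hz, sub_self]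
  exact zero_mem _

/-- The homomorphism `R / J → (R / J)ᵐᵒᵖ` induced by the involution. -/
def Ring.jacobsonQuotientStar (R : Type*) [Ring R] [StarRing R] :
    R ⧸ Ring.jacobson R →+* (R ⧸ Ring.jacobson R)ᵐᵒᵖ :=
  Ideal.Quotient.lift (Ring.jacobson R)
    ((RingHom.op (Ideal.Quotient.mk (Ring.jacobson R))).comp (starRingEquiv : R ≃+* Rᵐᵒᵖ))
    fun _ hx => congrArg MulOpposite.op
      (Ideal.Quotient.eq_zero_iff_mem.mpr (Ring.star_mem_jacobson hx))

instance Ring.jacobsonQuotientStarRing (R : Type*) [Ring R] [StarRing R] :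
    StarRing (R ⧸ Ring.jacobson R) where
  star x := (Ring.jacobsonQuotientStar R x).unop
  star_involutive x := by
    obtain ⟨x, rfl⟩ := Ideal.Quotient.mk_surjective x
    change Ideal.Quotient.mk _ (star (star x)) = _
    rw [star_star]
  star_mul x y := by
    change (Ring.jacobsonQuotientStar R (x * y)).unop = _
    rw [map_mul, MulOpposite.unop_mul]
  star_add x y := by
    change (Ring.jacobsonQuotientStar R (x + y)).unop = _
    rw [map_add, MulOpposite.unop_add]

theorem IsSemilocal.isSemisimpleRing (h : IsSemilocal R) :
    IsSemisimpleRing (R ⧸ Ring.jacobson R) := by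
  obtain ⟨N, D, d, _, -, ⟨f⟩⟩ := h
  exact f.symm.isSemisimpleRing

end Jacobson

theorem mem_peirceComponent_iff {R : Type*} [NonUnitalRing R] {a b x : R} (ha : a * a = a)
    (hb : b * b = b) : x ∈ peirceComponent a b ↔ a * x = x ∧ x * b = x := by
  constructor
  · rintro ⟨r, rfl⟩
    exact ⟨by rw [← mul_assoc, ← mul_assoc, ha], by rw [mul_assoc, hb]⟩
  · rintro ⟨h1, h2⟩
    exact ⟨x, by rw [h1, h2]⟩

/-! ### Lifting unimodularity from the semisimple quotient. -/

section StableRank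

variable {R : Type*} [Ring R]

theorem rightUnimodular_of_sub_mem_jacobson {e : R} (he : e * e = e) {k : ℕ} {u z : Fin k → R}
    (hu : ∀ i, u i * e = u i) (hz : ∀ i, z i * e = z i)
    (h : ∑ i, z i * u i - e ∈ Ring.jacobson R) : RightUnimodular e u := by
  -- Adding `1 - e` makes the sum a unit of `R`, and multiplying that unit by `e` on the right
  -- recovers the sum.
  obtain ⟨s, hs⟩ := (Ring.isUnit_of_sub_one_mem_jacobson (r := ∑ i, z i * u i - e + 1)
    (by rwa [add_sub_cancel_right])).exists_left_inv
  refine ⟨fun i => e * s * z i, fun i => ⟨s * z i, ?_⟩, ?_⟩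
  · simp only [mul_assoc, hz]
  · have h1 : (∑ i, z i * u i - e + 1) * e = ∑ i, z i * u i := by
      rw [add_mul, sub_mul, he, one_mul, sub_add_cancel, Finset.sum_mul]
      exact Finset.sum_congr rfl fun i _ => by rw [mul_assoc, hu]
    simp only [mul_assoc, ← Finset.mul_sum]
    rw [← h1, ← mul_assoc s, hs, one_mul, he]

theorem stableRankLE_one_of_isSemilocal (hR : IsSemilocal R) {e : R} (he : e * e = e) :
    StableRankLE e 1 := by
  have := hR.isSemisimpleRing
  set q := Ideal.Quotient.mk (Ring.jacobson R)
  intro x hx hux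
  obtain ⟨y, -, hy⟩ := hux
  have hx' := fun i => (mem_peirceComponent_iff he he).mp (hx i)
  have hqe : q e * q e = q e := by rw [← map_mul, he]
  have hq1 : ∀ i, q e * q (x i) = q (x i) := fun i => by rw [← map_mul, (hx' i).1]
  have hq2 : ∀ i, q (x i) * q e = q (x i) := fun i => by rw [← map_mul, (hx' i).2]
  rw [Fin.sum_univ_two] at hy
  obtain ⟨a, z, ⟨ha1, ha2⟩, ⟨hz1, hz2⟩, h⟩ := exists_mul_add_mul_eq hqe (hq1 0) (hq2 0) (hq1 1)
    (hq2 1) (y₁ := q (y 0)) (y₂ := q (y 1)) (by rw [← hy, map_add, map_mul, map_mul])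
  obtain ⟨a, rfl⟩ := Ideal.Quotient.mk_surjective a
  obtain ⟨z, rfl⟩ := Ideal.Quotient.mk_surjective z
  refine ⟨fun _ => e * a * e, fun _ => ⟨a, rfl⟩, ?_⟩
  refine rightUnimodular_of_sub_mem_jacobson he (z := fun _ => e * z * e) (fun i => ?_)
    (fun i => by rw [mul_assoc, he]) ?_
  · rw [add_mul, mul_assoc _ _ e, (hx' _).2, (hx' _).2]
  · rw [← Ideal.Quotient.eq]
    change q _ = q e
    rw [Fin.sum_univ_one]
    simp only [map_mul, map_add]
    change q e * q a = q a at ha1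
    change q a * q e = q a at ha2
    change q e * q z = q z at hz1
    change q z * q e = q z at hz2
    rw [ha1, ha2, hz1, hz2]
    exact h

theorem exists_alternating_rightUnimodular [StarRing R] (hR : IsSemilocal R) {e : R}
    (he : e * e = e) {xm xp ym yp : Fin 2 → R}
    (hm : ∀ i, star e * xm i = xm i ∧ xm i * e = xm i)
    (hp : ∀ i, e * xp i = xp i ∧ xp i * e = xp i)
    (h : ∑ i, ym i * xm i + ∑ i, yp i * xp i = e) :
    ∃ c : Fin 2 → Fin 2 → R, (∀ i j, e * c i j = c i j ∧ c i j * star e = c i j) ∧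
      RightUnimodular e (fun i => xp i + ∑ j, (star (c j i) - c i j) * xm j) := by
  have := hR.isSemisimpleRing
  set q := Ideal.Quotient.mk (Ring.jacobson R)
  have hqs : ∀ x, q (star x) = star (q x) := fun x => rfl
  have hese : star e * star e = star e := by rw [← star_mul, he]
  -- Applying the involution exchanges left and right coefficients, so the starred relation is one
  -- for rows with `p = star e`.
  obtain ⟨b, hb, z, hz, hbz⟩ := exists_perturbation_unimodular (p := q (star e))
    (X := fun i => q (star (xp i))) (Y := fun i => q (star (xm i)))
    (y := fun i => q (star (ym i))) (z := fun i => q (star (yp i)))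
    (by rw [← map_mul, hese])
    (by
      funext i
      change q _ * q _ = _
      rw [← map_mul, ← star_mul, (hp i).2])
    (fun i => by rw [← map_mul, ← star_mul, (hp i).1])
    (by
      funext i
      change q _ * q _ = _
      rw [← map_mul, ← star_mul, (hm i).2])
    (fun i => by rw [← hqs, star_star, ← map_mul, ← (hm i).1, star_mul, star_star, mul_assoc, he])
    (by
      conv_rhs => rw [← h]
      simp only [star_add, star_sum, star_mul, map_add, map_sum, map_mul])
  choose b₀ hb₀ using fun i j => Ideal.Quotient.mk_surjective (b i j)
  choose z₀ hz₀ using fun i => Ideal.Quotient.mk_surjective (z i)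
  have hc : ∀ i j, q (e * b₀ i j * star e) = b i j := fun i j => by
    rw [map_mul, map_mul]
    have h1 := hb i j
    rw [← hqs, star_star] at h1
    change q e * Ideal.Quotient.mk _ (b₀ i j) * _ = _
    rw [hb₀, h1.1, h1.2]
  have hζ : ∀ i, star (q (e * star (z₀ i) * e)) = z i := fun i => by
    rw [← hqs, star_mul, star_mul, star_star, map_mul, map_mul]
    change q (star e) * (Ideal.Quotient.mk _ (z₀ i) * _) = _
    rw [hz₀, (hz i).2, (hz i).1]
  refine ⟨fun i j => e * b₀ i j * star e, fun i j => ⟨by rw [← mul_assoc, ← mul_assoc, he],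
    by rw [mul_assoc, hese]⟩, ?_⟩
  refine rightUnimodular_of_sub_mem_jacobson he (z := fun i => e * star (z₀ i) * e) (fun i => ?_)
    (fun i => by rw [mul_assoc, he]) ?_
  · rw [add_mul, Finset.sum_mul, (hp i).2]
    simp only [mul_assoc _ _ e, (hm _).2]
  · rw [← Ideal.Quotient.eq]
    change q _ = q e
    rw [← star_star e, hqs, ← hbz, star_sum, map_sum]
    refine Finset.sum_congr rfl fun i _ => ?_
    rw [star_star, star_mul, ← hζ, star_star, map_mul]
    congr 1
    rw [star_add, star_sum, map_add, map_sum, hqs, star_star]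
    congr 1
    refine Finset.sum_congr rfl fun j _ => ?_
    rw [map_mul, map_sub, hqs, hc, hc, star_mul, star_sub, star_star, hqs, star_star]

end StableRank

/-! ### Application to odd form rings. -/

namespace OddFormRing

variable {R Δ : Type*} [NonUnitalRing R] [StarRing R] [AddGroup Δ] {O : OddFormRing R Δ}

theorem HyperbolicPair.star_em (η : O.HyperbolicPair) : star η.em = η.ep := by
  rw [← η.star_ep, star_star]

theorem HyperbolicPair.star_e (η : O.HyperbolicPair) : star η.e = η.e := by
  rw [HyperbolicPair.e, star_add, η.star_em, η.star_ep, add_comm]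

namespace HyperbolicFamily

variable {n : ℕ} (F : O.HyperbolicFamily n)

theorem star_eEven : star F.eEven = F.eEven := by
  simp only [eEven, star_sum, HyperbolicPair.star_e]

theorem eEven_mul_ep (t : Fin n) : F.eEven * (F.η t).ep = (F.η t).ep := by
  have h1 : (F.η t).e * (F.η t).ep = (F.η t).ep := by
    rw [HyperbolicPair.e, add_mul, (F.η t).em_mul_ep, (F.η t).ep_idem, zero_add]
  rw [eEven, Finset.sum_mul, Finset.sum_eq_single t, h1]
  · intro j _ hj
    rw [← h1, ← mul_assoc, (F.orthogonal j t hj).1, zero_mul]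
  · simp

theorem em_mul_eEven (t : Fin n) : (F.η t).em * F.eEven = (F.η t).em := by
  rw [← (F.η t).star_ep, ← F.star_eEven, ← star_mul, eEven_mul_ep]

/-- The witness is `φ w`: the hermitian idempotent `e_{0'}` fixes `w` on both sides, so `φ w = φ w ·
e_{0'}`. -/
theorem sub_star_mem_evenFormParameter {t : Fin n} {w : R} (h1 : (F.η t).ep * w = w)
    (h2 : w * (F.η t).em = w) : w - star w ∈ F.evenFormParameter := by
  refine ⟨O.φ w, ⟨O.φ w, ?_⟩, O.π_φ w, (O.ρ_φ w).symm⟩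
  rw [← O.φ_conj, F.star_eEven]
  conv_rhs => rw [← h1, ← h2]
  rw [← mul_assoc, ← mul_assoc, F.eEven_mul_ep, mul_assoc, F.em_mul_eEven, mul_assoc, h2, h1]

theorem lambdaStableRankLE_zero_iff (t : Fin n) :
    F.LambdaStableRankLE t 0 ↔ (F.η t).ep = 0 := by
  constructor
  · rintro ⟨h, -⟩
    have he := (F.η t).ep_idem
    have hmem : (F.η t).ep ∈ peirceComponent (F.η t).ep (F.η t).ep :=
      (mem_peirceComponent_iff he he).mpr ⟨he, he⟩
    -- Here `k = 1`, so the shortened sequence is empty and its unimodularity says that the identity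
    -- is an empty sum.
    obtain ⟨a, -, y, -, hy⟩ := h (fun _ => (F.η t).ep) (fun _ => hmem)
      ⟨fun _ => (F.η t).ep, fun _ => hmem, by simpa using he⟩
    simpa using hy.symm
  · intro he
    have hem : (F.η t).em = 0 := by rw [← (F.η t).star_ep, he, star_zero]
    have h0 : ∀ k (x : Fin k → R), RightUnimodular (0 : R) x := fun k x =>
      ⟨0, fun _ => ⟨0, by simp⟩, by simp⟩
    refine ⟨fun x _ _ => ⟨0, fun i => i.elim0, he ▸ h0 _ _⟩, fun xm xp _ _ _ => ?_⟩
    refine ⟨0, fun i j => ⟨0, by simp⟩, by simp, fun i => ?_, he ▸ h0 _ _⟩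
    have := F.sub_star_mem_evenFormParameter (t := t) (w := 0) (by simp) (by simp)
    simpa using this

theorem lambdaStableRank_le {t : Fin n} {m : ℕ} (h : F.LambdaStableRankLE t m) :
    F.lambdaStableRank t ≤ m :=
  sInf_le ⟨m, rfl, h⟩

theorem lambdaStableRank_eq_zero_iff (t : Fin n) :
    F.lambdaStableRank t = 0 ↔ F.LambdaStableRankLE t 0 := by
  constructor
  · intro h
    rw [lambdaStableRank, ENat.sInf_eq_zero] at h
    obtain ⟨m, hm, h⟩ := h
    rw [eq_comm, Nat.cast_eq_zero] at hm
    exact hm ▸ h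
  · intro h
    exact nonpos_iff_eq_zero.mp (F.lambdaStableRank_le h)

end HyperbolicFamily

theorem IsSemilocal.lambdaStableRankLE_one {R Δ : Type*} [Ring R] [StarRing R] [AddGroup Δ]
    {O : OddFormRing R Δ} (hO : O.IsSemilocal) {n : ℕ} (F : O.HyperbolicFamily n) (t : Fin n) :
    F.LambdaStableRankLE t 1 := by
  have he := (F.η t).ep_idem
  have hem := (F.η t).em_idem
  refine ⟨stableRankLE_one_of_isSemilocal hO he, ?_⟩
  rintro xm xp hm hp ⟨ym, yp, -, -, h⟩
  have hstar := (F.η t).star_ep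
  obtain ⟨c, hc, hu⟩ := exists_alternating_rightUnimodular hO he
    (fun i => hstar ▸ (mem_peirceComponent_iff hem he).mp (hm i))
    (fun i => (mem_peirceComponent_iff he he).mp (hp i)) h
  have hc' : ∀ i j, (F.η t).ep * star (c i j) = star (c i j) ∧
      star (c i j) * (F.η t).em = star (c i j) := fun i j => by
    constructor
    · conv_rhs => rw [← (hc i j).2, star_mul, star_star]
    · rw [← hstar, ← star_mul, (hc i j).1]
  rw [hstar] at hc
  refine ⟨fun i j => star (c j i) - c i j, fun i j => ?_, fun i j => ?_, fun i => ?_, hu⟩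
  · rw [mem_peirceComponent_iff he hem, mul_sub, sub_mul, (hc' j i).1, (hc' j i).2, (hc i j).1,
      (hc i j).2]
    exact ⟨rfl, rfl⟩
  · rw [star_sub, star_star, neg_sub]
  · have := F.sub_star_mem_evenFormParameter (hc' i i).1 (hc' i i).2
    rwa [star_star] at this

end OddFormRing

theorem mainTheorem7 {R Δ : Type*} [Ring R] [StarRing R] [AddGroup Δ] (O : OddFormRing R Δ)
    (hO : O.IsSemilocal) (n : ℕ) (hn : 0 < n) (F : O.HyperbolicFamily n) (hF : F.IsFree) :
    F.LambdaStableRankLE ⟨0, hn⟩ 1 ∧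
    F.lambdaStableRank ⟨0, hn⟩ ≤ 1 ∧
    (F.lambdaStableRank ⟨0, hn⟩ = 0 ↔
      peirceComponent (F.η ⟨0, hn⟩).ep (F.η ⟨0, hn⟩).ep = {0}) := by
  have h1 := hO.lambdaStableRankLE_one F ⟨0, hn⟩
  refine ⟨h1, by simpa using F.lambdaStableRank_le h1, ?_⟩
  rw [F.lambdaStableRank_eq_zero_iff, F.lambdaStableRankLE_zero_iff]
  have he := (F.η ⟨0, hn⟩).ep_idem
  constructor
  · intro h
    ext x
    rw [mem_peirceComponent_iff he he, h, Set.mem_singleton_iff]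
    constructor
    · rintro ⟨hx, -⟩
      rw [← hx, zero_mul]
    · rintro rfl
      simp
  · intro h
    have : (F.η ⟨0, hn⟩).ep ∈ peirceComponent (F.η ⟨0, hn⟩).ep (F.η ⟨0, hn⟩).ep :=
      (mem_peirceComponent_iff he he).mpr ⟨he, he⟩
    rwa [h] at this
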